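/- For $x\in\mathbb R$ let $\|x\|$ be the distance from $x$ to the nearest integer. Let $k\ge 2$ be an integer, and let $\boldsymbol\alpha=(\alpha_1,\dots,\alpha_{k-1})\in\mathbb R^{k-1}$. Let $\omega^\times(\boldsymbol\alpha)\in[-\infty,\infty]$ be the supremum of the real numbers $w$ such that $\|n\alpha_1\|\cdots\|n\alpha_{k-1}\|<n^{-w}$ for infinitely many positive integers $n$, and assume that $\omega^\times(\boldsymbol\alpha)<\frac{k-1}{k-2}$ (that is, $\omega^\times(\boldsymbol\alpha)<\infty$ if $k=2$). For $\boldsymbol\gamma\in\mathbb R^{k-1}$, $\boldsymbol\delta=(\delta_1,\dots,\delta_{k-1})\in\mathbb R^{k-1}$ and a positive integer $N$, define the Bohr set $$B_{\boldsymbol\alpha}^{\boldsymbol\gamma}(N;\boldsymbol\delta)=\{n\in\mathbb Z:\ |n|\le N,\ \|n\alpha_i-\gamma_i\|\le\delta_i\ (1\le i\le k-1)\},$$ and for positive integers $A_1,\dots,A_k,N_1,\dots,N_k$ put $$P(0;A_1,\dots,A_k;N_1,\dots,N_k)=\{A_1n_1+\dots+A_kn_k:\ n_i\in\mathbb Z,\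 |n_i|\le N_i\ (1\le i\le k)\}.$$ Then there are $\tau_0>0$, $C>0$ and a positive integer $N_0$, depending only on $k$ and $\boldsymbol\alpha$, such that for all $0<\tau\le\tau_0$ and all integers $N\ge N_0$ the following hold. 1. (Outer structure.) If $N^{-\tau}\le\delta_i\le 2$ for $1\le i\le k-1$, then there are positive integers $A_1,\dots,A_k,N_1,\dots,N_k$ such that $P'=P(0;A_1,\dots,A_k;N_1,\dots,N_k)$ satisfies $$B_{\boldsymbol\alpha}^{\mathbf 0}(N;\boldsymbol\delta)\subseteq P',\qquad \#P'\le C\,\delta_1\cdots\delta_{k-1}N.$$ 2. (Cardinality bound.) If $N^{-\tau}\le\delta_i\le 1$ for $1\le i\le k-1$, then for every $\boldsymbol\gamma\in\mathbb R^{k-1}$ $$\#B_{\boldsymbol\alpha}^{\boldsymbol\gamma}(N;\boldsymbol\delta)\le C\,\delta_1\cdots\delta_{k-1}N.$$ -/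

import Mathlib

/-- The distance `‖x‖` from a real number `x` to the nearest integer. -/
noncomputable def distInt (x : ℝ) : ℝ := |x - (round x : ℝ)|

/-- The multiplicative exponent `ω^×(α)` of a real vector `α = (α₁, …, α_d)`: the supremum, in the
extended reals, of all real `w` such that `‖nα₁‖ ⋯ ‖nα_d‖ < n^(-w)` holds for infinitely many
positive integers `n`. -/
noncomputable def multExponent {d : ℕ} (α : Fin d → ℝ) : EReal :=
  sSup {e : EReal | ∃ w : ℝ, e = (w : EReal) ∧
    {n : ℕ | 0 < n ∧ ∏ i, distInt ((n : ℝ) * α i) < (n : ℝ) ^ (-w)}.Infinite}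

/-- The quantity `(k - 1) / (k - 2)`, for `k ≥ 2`, read as `+∞` when `k = 2`. -/
noncomputable def exponentThreshold (k : ℕ) : EReal :=
  if k = 2 then ⊤ else ((((k : ℝ) - 1) / ((k : ℝ) - 2) : ℝ) : EReal)

/-- The Bohr set `B_α^γ(N; δ)`: all integers `n` with `|n| ≤ N` and `‖nα_i - γ_i‖ ≤ δ_i` for
every `i`. -/
def bohrSet {d : ℕ} (α γ : Fin d → ℝ) (N : ℕ) (δ : Fin d → ℝ) : Set ℤ :=
  {n : ℤ | |n| ≤ (N : ℤ) ∧ ∀ i, distInt ((n : ℝ) * α i - γ i) ≤ δ i}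

/-- The generalised arithmetic progression
`P(b; A₁, …, A_k; L₁, …, L_k) = {b + A₁ n₁ + ⋯ + A_k n_k : |n_i| ≤ L_i}`, the `n_i` being
integers. -/
def genArithProg {k : ℕ} (b : ℤ) (A L : Fin k → ℕ) : Set ℤ :=
  {n : ℤ | ∃ m : Fin k → ℤ, (∀ i, |m i| ≤ (L i : ℤ)) ∧ n = b + ∑ i, (A i : ℤ) * m i}

/-! This is geometry of numbers with d = k - 1. The map (n, z) ↦ (n/N, (nα_i - z_i)/δ_i) embeds
ℤ^(d+1) as a lattice of covolume 1/P, P = δ_1⋯δ_d N, and elements of the homogeneous Bohr set lift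
to lattice points of bounded norm. In a Hermite-reduced basis v_i (`exists_reduced_family`) such
points have coefficients O(1/‖v_i‖); reading off the n-coordinate gives a progression with steps
|v_i(0)| and lengths L_i ≪ 1 + 1/‖v_i‖.

Its size is O(P) as soon as every ‖v_i‖ is O(1), because ∏‖v_i‖ ≥ 1/P by Hadamard. This is where ω^×
enters: every nonzero lattice vector satisfies ‖v‖^d ≫ 1/P (`bohrEmbedding_norm_lower_bound`), while
∏‖v_i‖ ≪ 1/P over d + 1 factors, so no single factor can be large. The inhomogeneous bound follows
by taking differences. -/

/-! ### Shortest vectors in discrete lattices -/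

section ShortestVector

variable {E H : Type*} [AddCommGroup E] [NormedAddCommGroup H]

/-- A nonzero kernel element would put all of its infinitely many integer multiples in one sublevel
set. -/
theorem norm_pos_of_finite_sublevel [Module.IsTorsionFree ℤ E] (f : E →ₗ[ℤ] H)
    (hf : ∀ R : ℝ, {x | ‖f x‖ ≤ R}.Finite) {x : E} (hx : x ≠ 0) : 0 < ‖f x‖ := by
  by_contra h
  have h0 : ‖f x‖ = 0 := le_antisymm (not_lt.mp h) (norm_nonneg _)
  have h0' : f x = 0 := norm_eq_zero.mp h0
  refine (Set.infinite_of_injective_forall_mem (s := {x | ‖f x‖ ≤ 0}) (f := fun n : ℤ => n • x)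
    ?_ ?_) (hf 0)
  · exact smul_left_injective ℤ hx
  · intro n
    simp [h0']

theorem exists_shortest_vector [Module.IsTorsionFree ℤ E] [Nontrivial E] (f : E →ₗ[ℤ] H)
    (hf : ∀ R : ℝ, {x | ‖f x‖ ≤ R}.Finite) :
    ∃ v : E, v ≠ 0 ∧ ∀ x : E, x ≠ 0 → ‖f v‖ ≤ ‖f x‖ := by
  obtain ⟨e, he⟩ := exists_ne (0 : E)
  obtain ⟨v, hv, hmin⟩ := Set.exists_min_image {x : E | x ≠ 0 ∧ ‖f x‖ ≤ ‖f e‖} (fun x => ‖f x‖)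
    ((hf ‖f e‖).subset fun x hx => hx.2) ⟨e, he, le_rfl⟩
  refine ⟨v, hv.1, fun x hx => ?_⟩
  by_cases hxe : ‖f x‖ ≤ ‖f e‖
  · exact hmin x ⟨hx, hxe⟩
  · exact hv.2.trans (not_le.mp hxe).le

end ShortestVector

/-! ### Orthogonal projection and Hermite reduction -/

section Reduction

variable {H : Type*} [NormedAddCommGroup H] [InnerProductSpace ℝ H]

/-- The component of a vector orthogonal to `u`. -/
noncomputable def rejection (u : H) : H →ₗ[ℝ] H :=
  LinearMap.id - (‖u‖ ^ 2)⁻¹ • (innerₗ H u).smulRight u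

theorem rejection_apply (u x : H) :
    rejection u x = x - ((‖u‖ ^ 2)⁻¹ * inner ℝ u x) • u := by
  simp [rejection, smul_smul]

theorem rejection_self {u : H} (hu : u ≠ 0) : rejection u u = 0 := by
  have : ‖u‖ ^ 2 ≠ 0 := by simpa using hu
  rw [rejection_apply, real_inner_self_eq_norm_sq, inv_mul_cancel₀ this, one_smul, sub_self]

theorem inner_rejection {u : H} (hu : u ≠ 0) (x y : H) :
    inner ℝ (rejection u x) (rejection u y) =
      inner ℝ x y - inner ℝ x u * (‖u‖ ^ 2)⁻¹ * inner ℝ u y := by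
  have : ‖u‖ ^ 2 ≠ 0 := by simpa using hu
  simp only [rejection_apply, inner_sub_left, inner_sub_right, real_inner_smul_left,
    real_inner_smul_right, real_inner_self_eq_norm_sq, real_inner_comm x u]
  field_simp
  ring

theorem norm_sq_rejection {u : H} (hu : u ≠ 0) (x : H) :
    ‖rejection u x‖ ^ 2 = ‖x‖ ^ 2 - inner ℝ u x ^ 2 / ‖u‖ ^ 2 := by
  rw [← real_inner_self_eq_norm_sq, inner_rejection hu, real_inner_self_eq_norm_sq,
    real_inner_comm x u]
  ring

theorem norm_rejection_le {u : H} (hu : u ≠ 0) (x : H) : ‖rejection u x‖ ≤ ‖x‖ := by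
  refine le_of_sq_le_sq ?_ (norm_nonneg x)
  rw [norm_sq_rejection hu]
  have : 0 ≤ inner ℝ u x ^ 2 / ‖u‖ ^ 2 := by positivity
  linarith

/-- Squared volume is squared base times squared height: row operations clear the first column,
leaving the Gram matrix of the projections as Schur complement. -/
theorem det_gram_cons {n : ℕ} {u : H} (hu : u ≠ 0) (w : Fin n → H) :
    (Matrix.gram ℝ (Fin.cons u w : Fin (n + 1) → H)).det =
      ‖u‖ ^ 2 * (Matrix.gram ℝ (fun i => rejection u (w i))).det := by
  have hu2 : ‖u‖ ^ 2 ≠ 0 := by simpa using hu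
  set A := Matrix.gram ℝ (Fin.cons u w : Fin (n + 1) → H) with hA
  let c : Fin (n + 1) → ℝ := Fin.cons 0 fun i => inner ℝ (w i) u * (‖u‖ ^ 2)⁻¹
  let B : Matrix (Fin (n + 1)) (Fin (n + 1)) ℝ := Matrix.of fun i j => A i j - c i * A 0 j
  have hAB : A.det = B.det := by
    refine Matrix.det_eq_of_forall_row_eq_smul_add_const c 0 rfl fun i j => ?_
    simp [B, c]
  have hcol : ∀ i : Fin n, B i.succ 0 = 0 := fun i => by
    simp only [B, A, c, Matrix.of_apply, Matrix.gram_apply, Fin.cons_succ, Fin.cons_zero,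
      real_inner_self_eq_norm_sq]
    field_simp
    ring
  have h00 : B 0 0 = ‖u‖ ^ 2 := by
    simp [B, A, c, Matrix.gram_apply]
  have hsub : B.submatrix (Fin.succAbove 0) Fin.succ =
      Matrix.gram ℝ (fun i => rejection u (w i)) := by
    ext i j
    simp only [Matrix.submatrix_apply, Matrix.gram_apply, inner_rejection hu]
    simp [B, A, c, Matrix.gram_apply]
  rw [hAB, Matrix.det_succ_column_zero, Fin.sum_univ_succ]
  rw [hsub]
  simp [hcol, h00]

section Lattice

variable {E : Type*} [AddCommGroup E]

/-- A shortest vector is primitive: if m x = a v, subtracting from x the multiple of v nearest to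
(a/m) v leaves a vector of length at most ‖f v‖/2, which must vanish. -/
theorem isTorsionFree_quotient_shortest [Module.IsTorsionFree ℤ E] (f : E →ₗ[ℤ] H)
    (hf : ∀ R : ℝ, {x | ‖f x‖ ≤ R}.Finite) {v : E} (hv : v ≠ 0)
    (hmin : ∀ x : E, x ≠ 0 → ‖f v‖ ≤ ‖f x‖) :
    Module.IsTorsionFree ℤ (E ⧸ Submodule.span ℤ {v}) := by
  have key : ∀ (m : ℤ), m ≠ 0 → ∀ x : E, m • x ∈ Submodule.span ℤ {v} →
      x ∈ Submodule.span ℤ {v} := by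
    intro m hm x hx
    obtain ⟨a, ha⟩ := Submodule.mem_span_singleton.mp hx
    have hm' : (m : ℝ) ≠ 0 := by exact_mod_cast hm
    set c := round ((a : ℝ) / m)
    have hsm : m • (x - c • v) = (a - c * m) • v := by
      rw [smul_sub, ← ha, smul_smul, sub_smul, mul_comm]
    have hn : |(m : ℝ)| * ‖f (x - c • v)‖ = |(a : ℝ) - c * m| * ‖f v‖ := by
      have := congrArg (fun y => ‖f y‖) hsm
      simp only [map_smul] at this
      rw [← Int.cast_smul_eq_zsmul ℝ m, ← Int.cast_smul_eq_zsmul ℝ (a - c * m), norm_smul,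
        norm_smul, Real.norm_eq_abs, Real.norm_eq_abs] at this
      simpa using this
    have hc : |(a : ℝ) - c * m| ≤ |(m : ℝ)| / 2 := by
      have h1 := abs_sub_round ((a : ℝ) / m)
      have h2 : (a : ℝ) - c * m = m * (a / m - c) := by field_simp
      rw [h2, abs_mul]
      nlinarith [abs_nonneg (m : ℝ)]
    have hx0 : x - c • v = 0 := by
      by_contra h0
      have h1 := hmin _ h0
      have h2 := norm_pos_of_finite_sublevel f hf hv
      have h3 : 0 < |(m : ℝ)| := abs_pos.mpr hm'
      nlinarith [mul_le_mul_of_nonneg_left h1 h3.le, mul_le_mul_of_nonneg_right hc h2.le,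
        mul_pos h3 h2]
    rw [sub_eq_zero.mp hx0]
    exact Submodule.smul_mem _ _ (Submodule.mem_span_singleton_self v)
  refine Module.IsTorsionFree.of_smul_eq_zero fun m y hmy => ?_
  obtain ⟨x, rfl⟩ := Submodule.Quotient.mk_surjective _ y
  rw [or_iff_not_imp_left]
  intro hm
  rw [← Submodule.Quotient.mk_smul, Submodule.Quotient.mk_eq_zero] at hmy
  exact (Submodule.Quotient.mk_eq_zero _).mpr (key m hm x hmy)

/-- The map induced by `f` on `E ⧸ ℤv`, with values in the orthogonal complement of `f v`. -/
noncomputable def quotientRejection (f : E →ₗ[ℤ] H) (v : E) (hv : f v ≠ 0) :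
    (E ⧸ Submodule.span ℤ {v}) →ₗ[ℤ] H :=
  (Submodule.span ℤ {v}).liftQ (((rejection (f v)).restrictScalars ℤ).comp f) <| by
    rw [Submodule.span_singleton_le_iff_mem]
    simp [rejection_self hv]

theorem quotientRejection_mk (f : E →ₗ[ℤ] H) (v : E) (hv : f v ≠ 0) (x : E) :
    quotientRejection f v hv (Submodule.Quotient.mk x) = rejection (f v) (f x) := by
  simp [quotientRejection]

/-- Size reduction: translating by a multiple of v brings the component along f v to at most half of
‖f v‖; then Pythagoras. -/
theorem exists_lift_norm_sq_le (f : E →ₗ[ℤ] H) (v : E) (hv : f v ≠ 0)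
    (y : E ⧸ Submodule.span ℤ {v}) :
    ∃ x : E, Submodule.Quotient.mk x = y ∧
      ‖f x‖ ^ 2 ≤ ‖quotientRejection f v hv y‖ ^ 2 + ‖f v‖ ^ 2 / 4 := by
  obtain ⟨z, rfl⟩ := Submodule.Quotient.mk_surjective _ y
  have hpos : 0 < ‖f v‖ ^ 2 := by positivity
  set t : ℝ := inner ℝ (f v) (f z) / ‖f v‖ ^ 2 with ht
  set c := round t
  have hmk : (Submodule.Quotient.mk (z - c • v) : E ⧸ Submodule.span ℤ {v}) =
      Submodule.Quotient.mk z := by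
    rw [Submodule.Quotient.eq]
    have : z - c • v - z = (-c) • v := by
      rw [neg_smul]; abel
    rw [this]
    exact Submodule.smul_mem _ _ (Submodule.mem_span_singleton_self v)
  refine ⟨z - c • v, hmk, ?_⟩
  rw [← hmk, quotientRejection_mk, norm_sq_rejection hv]
  have hin : inner ℝ (f v) (f (z - c • v)) = ‖f v‖ ^ 2 * (t - c) := by
    rw [map_sub, map_smul, ← Int.cast_smul_eq_zsmul ℝ c, inner_sub_right, real_inner_smul_right,
      real_inner_self_eq_norm_sq, ht]
    field_simp
  have hr : (t - c) ^ 2 ≤ 1 / 4 := by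
    have := abs_sub_round t
    rw [← sq_abs]
    nlinarith [abs_nonneg (t - c)]
  rw [hin]
  have : (‖f v‖ ^ 2 * (t - c)) ^ 2 / ‖f v‖ ^ 2 = ‖f v‖ ^ 2 * (t - c) ^ 2 := by
    field_simp
  rw [this]
  nlinarith

theorem finite_sublevel_quotientRejection (f : E →ₗ[ℤ] H)
    (hf : ∀ R : ℝ, {x | ‖f x‖ ≤ R}.Finite) (v : E) (hv : f v ≠ 0) (R : ℝ) :
    {y | ‖quotientRejection f v hv y‖ ≤ R}.Finite := by
  refine ((hf (|R| + ‖f v‖)).image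
    (fun x => (Submodule.Quotient.mk x : E ⧸ Submodule.span ℤ {v}))).subset fun y hy => ?_
  obtain ⟨x, hx, hle⟩ := exists_lift_norm_sq_le f v hv y
  refine ⟨x, ?_, hx⟩
  have hy' : ‖quotientRejection f v hv y‖ ≤ |R| := le_trans hy (le_abs_self R)
  refine le_of_sq_le_sq (hle.trans ?_) (by positivity)
  nlinarith [norm_nonneg (quotientRejection f v hv y), norm_nonneg (f v), abs_nonneg R,
    mul_nonneg (abs_nonneg R) (norm_nonneg (f v))]

end Lattice

end Reduction

/-- Hermite reduction: a lattice has a generating family `v`, of size its rank, which is close to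
orthogonal in the sense that coefficients are controlled by norms and that the product of the
norms is comparable to the covolume. -/
theorem exists_reduced_family (H : Type*) [NormedAddCommGroup H] [InnerProductSpace ℝ H] (n : ℕ) :
    ∃ K : ℝ, 0 < K ∧ ∃ C : ℝ, 0 < C ∧ ∀ (E : Type) [AddCommGroup E] [Module.Finite ℤ E]
      [Module.IsTorsionFree ℤ E] (f : E →ₗ[ℤ] H), (∀ R : ℝ, {x | ‖f x‖ ≤ R}.Finite) →
      Module.finrank ℤ E = n → ∃ v : Fin n → E, (∀ i, v i ≠ 0) ∧
        (∀ x, ∃ m : Fin n → ℤ, x = ∑ i, m i • v i ∧ ∀ i, |(m i : ℝ)| * ‖f (v i)‖ ≤ K * ‖f x‖) ∧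
        ∏ i, ‖f (v i)‖ ^ 2 ≤ C * (Matrix.gram ℝ fun i => f (v i)).det ∧
        (Matrix.gram ℝ fun i => f (v i)).det ≤ ∏ i, ‖f (v i)‖ ^ 2 := by
  -- The lattice is a map into a fixed H, so E ⧸ ℤu with the projected map is again an instance, and
  -- the constants do not depend on E.
  induction n with
  | zero =>
    refine ⟨1, one_pos, 1, one_pos, fun E _ _ _ f _ hE => 
      ⟨Fin.elim0, fun i => i.elim0, fun x => ⟨Fin.elim0, ?_, ?_⟩, ?_, ?_⟩⟩
    · have := Module.finrank_zero_iff.mp hE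
      exact Subsingleton.elim _ _
    · exact fun i => i.elim0
    · simp
    · simp
  | succ n ih =>
    obtain ⟨K, hK, C, hC, ih⟩ := ih
    refine ⟨1 + 2 * n * K + 2 * K, by positivity, 4 ^ n * C, by positivity,
      fun E _ _ _ f hf hE => ?_⟩
    have : Nontrivial E := Module.nontrivial_of_finrank_pos (R := ℤ) (by omega)
    obtain ⟨u, hu, hmin⟩ := exists_shortest_vector f hf
    have hu' : 0 < ‖f u‖ := norm_pos_of_finite_sublevel f hf hu
    have hfu : f u ≠ 0 := norm_pos_iff.mp hu'
    have : Module.IsTorsionFree ℤ (E ⧸ Submodule.span ℤ {u}) :=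
      isTorsionFree_quotient_shortest f hf hu hmin
    have hrank : Module.finrank ℤ (E ⧸ Submodule.span ℤ {u}) = n := by
      have h1 := Submodule.finrank_quotient_add_finrank (Submodule.span ℤ {u})
      have h2 : Module.finrank ℤ (Submodule.span ℤ {u}) = 1 := by
        have hli : LinearIndependent ℤ (fun _ : Unit => u) :=
          (LinearIndependent.of_subsingleton () hu)
        have := finrank_span_eq_card hli
        rwa [Set.range_const, Fintype.card_unit] at this
      omega
    obtain ⟨w, hw, hspan, hlow, hupp⟩ := ih (E ⧸ Submodule.span ℤ {u}) (quotientRejection f u hfu)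
      (finite_sublevel_quotientRejection f hf u hfu) hrank
    choose x hx hxn using fun i => exists_lift_norm_sq_le f u hfu (w i)
    have hrej : ∀ i, quotientRejection f u hfu (w i) = rejection (f u) (f (x i)) := fun i => by
      rw [← hx i, quotientRejection_mk]
    have hx0 : ∀ i, x i ≠ 0 := fun i h => hw i (by rw [← hx i, h, Submodule.Quotient.mk_zero])
    -- Minimality of u gives ‖f u‖² / 4 ≤ ‖f (x i)‖² / 4, which is absorbed on the left; 4/3 would
    -- do in place of 4.
    have hcmp : ∀ i, ‖f (x i)‖ ^ 2 ≤ 4 * ‖quotientRejection f u hfu (w i)‖ ^ 2 := fun i => by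
      have h1 := hxn i
      have h2 := hmin _ (hx0 i)
      have h3 := pow_le_pow_left₀ hu'.le h2 2
      have h4 := sq_nonneg ‖quotientRejection f u hfu (w i)‖
      linarith
    have hcmp' : ∀ i, ‖f (x i)‖ ≤ 2 * ‖quotientRejection f u hfu (w i)‖ := fun i => by
      refine le_of_sq_le_sq ?_ (by positivity)
      linarith [hcmp i]
    have hcons : (fun i => f ((Fin.cons u x : Fin (n + 1) → E) i)) =
        (Fin.cons (f u) fun i => f (x i) : Fin (n + 1) → H) := by
      funext i
      refine Fin.cases ?_ (fun j => ?_) i <;> simp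
    have hdet : (Matrix.gram ℝ fun i => f ((Fin.cons u x : Fin (n + 1) → E) i)).det =
        ‖f u‖ ^ 2 * (Matrix.gram ℝ fun i => quotientRejection f u hfu (w i)).det := by
      rw [hcons, det_gram_cons hfu]
      simp only [hrej]
    refine ⟨Fin.cons u x, Fin.cases hu hx0, fun y => ?_, ?_, ?_⟩
    · obtain ⟨m, hm, hmK⟩ := hspan (Submodule.Quotient.mk y)
      have hmem : y - ∑ i, m i • x i ∈ Submodule.span ℤ {u} := by
        rw [← Submodule.Quotient.mk_eq_zero, Submodule.Quotient.mk_sub, hm, ← Submodule.mkQ_apply,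
          map_sum, sub_eq_zero]
        refine Finset.sum_congr rfl fun i _ => ?_
        rw [map_smul, Submodule.mkQ_apply, hx]
      obtain ⟨c, hc⟩ := Submodule.mem_span_singleton.mp hmem
      have hy : y = c • u + ∑ i, m i • x i := by rw [hc]; abel
      have hqy : ‖quotientRejection f u hfu (Submodule.Quotient.mk y)‖ ≤ ‖f y‖ := by
        rw [quotientRejection_mk]
        exact norm_rejection_le hfu _
      have htail : ∀ i, |(m i : ℝ)| * ‖f (x i)‖ ≤ 2 * K * ‖f y‖ := fun i => by
        calc |(m i : ℝ)| * ‖f (x i)‖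
            ≤ |(m i : ℝ)| * (2 * ‖quotientRejection f u hfu (w i)‖) := by
              gcongr; exact hcmp' i
          _ = 2 * (|(m i : ℝ)| * ‖quotientRejection f u hfu (w i)‖) := by ring
          _ ≤ 2 * (K * ‖quotientRejection f u hfu (Submodule.Quotient.mk y)‖) := by
              linarith [hmK i]
          _ ≤ 2 * (K * ‖f y‖) := by gcongr
          _ = 2 * K * ‖f y‖ := by ring
      refine ⟨Fin.cons c m, ?_, fun i => ?_⟩
      · rw [Fin.sum_univ_succ]
        simpa using hy
      · refine Fin.cases ?_ (fun j => ?_) i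
        · simp only [Fin.cons_zero]
          have h1 : f (c • u) = f y - ∑ i, f (m i • x i) := by
            rw [← map_sum, ← map_sub]
            congr 1
          have hns : ∀ (k : ℤ) (z : E), ‖f (k • z)‖ = |(k : ℝ)| * ‖f z‖ := fun k z => by
            rw [map_smul, ← Int.cast_smul_eq_zsmul ℝ k, norm_smul, Real.norm_eq_abs]
          calc |(c : ℝ)| * ‖f u‖ = ‖f y - ∑ i, f (m i • x i)‖ := by rw [← h1, hns]
            _ ≤ ‖f y‖ + ‖∑ i, f (m i • x i)‖ := norm_sub_le _ _
            _ ≤ ‖f y‖ + ∑ i : Fin n, 2 * K * ‖f y‖ := by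
              gcongr
              refine (norm_sum_le _ _).trans (Finset.sum_le_sum fun i _ => ?_)
              rw [hns]
              exact htail i
            _ = (1 + 2 * n * K) * ‖f y‖ := by
              simp
              ring
            _ ≤ (1 + 2 * n * K + 2 * K) * ‖f y‖ := by
              refine mul_le_mul_of_nonneg_right ?_ (norm_nonneg _)
              linarith
        · simp only [Fin.cons_succ]
          refine (htail j).trans ?_
          gcongr
          have : 0 ≤ 1 + 2 * n * K := by positivity
          linarith
    · rw [hdet, Fin.prod_univ_succ]
      simp only [Fin.cons_zero, Fin.cons_succ]
      have h1 : ∏ i, ‖f (x i)‖ ^ 2 ≤ ∏ i, (4 * ‖quotientRejection f u hfu (w i)‖ ^ 2) :=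
        Finset.prod_le_prod (fun i _ => by positivity) fun i _ => hcmp i
      rw [Finset.prod_mul_distrib, Finset.prod_const, Finset.card_univ, Fintype.card_fin] at h1
      calc ‖f u‖ ^ 2 * ∏ i, ‖f (x i)‖ ^ 2
          ≤ ‖f u‖ ^ 2 * (4 ^ n * ∏ i, ‖quotientRejection f u hfu (w i)‖ ^ 2) := by gcongr
        _ ≤ ‖f u‖ ^ 2 * (4 ^ n *
            (C * (Matrix.gram ℝ fun i => quotientRejection f u hfu (w i)).det)) := by gcongr
        _ = _ := by ring
    · rw [hdet, Fin.prod_univ_succ]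
      simp only [Fin.cons_zero, Fin.cons_succ]
      refine mul_le_mul_of_nonneg_left (hupp.trans ?_) (by positivity)
      refine Finset.prod_le_prod (fun i _ => by positivity) fun i _ => ?_
      rw [hrej]
      gcongr
      exact norm_rejection_le hfu _

/-! ### Diophantine lower bounds from the multiplicative exponent -/

theorem distInt_nonneg (x : ℝ) : 0 ≤ distInt x := abs_nonneg _

theorem distInt_le_abs_sub (x : ℝ) (z : ℤ) : distInt x ≤ |x - z| := round_le x z

theorem distInt_neg_le (x : ℝ) : distInt (-x) ≤ distInt x := by
  refine (distInt_le_abs_sub (-x) (-round x)).trans (le_of_eq ?_)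
  rw [distInt, ← abs_neg]
  push_cast
  ring_nf

/-- A zero factor at n stays zero at every multiple of n, which would make every w admissible. -/
theorem prod_distInt_pos {d : ℕ} (α : Fin d → ℝ) (hα : multExponent α ≠ ⊤) {n : ℕ} (hn : 0 < n) :
    0 < ∏ i, distInt ((n : ℝ) * α i) := by
  refine lt_of_le_of_ne (Finset.prod_nonneg fun i _ => distInt_nonneg _) fun h0 => hα ?_
  obtain ⟨i, -, hi⟩ := Finset.prod_eq_zero_iff.mp h0.symm
  have hzero : ∀ t : ℕ, ∏ i, distInt (((t * n : ℕ) : ℝ) * α i) = 0 := fun t => by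
    refine Finset.prod_eq_zero (Finset.mem_univ i) (le_antisymm ?_ (distInt_nonneg _))
    refine (distInt_le_abs_sub _ (t * round ((n : ℝ) * α i))).trans (le_of_eq ?_)
    rw [distInt, abs_eq_zero, sub_eq_zero] at hi
    push_cast
    rw [← hi, mul_assoc, sub_self, abs_zero]
  have hall : ∀ w : ℝ, (w : EReal) ≤ multExponent α := fun w => by
    refine le_sSup ⟨w, rfl, ?_⟩
    refine Set.infinite_of_injective_forall_mem (f := fun t : ℕ => (t + 1) * n) ?_ fun t => ?_
    · intro a b hab
      simpa using Nat.eq_of_mul_eq_mul_right hn hab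
    · have hp : 0 < (t + 1) * n := by positivity
      refine ⟨hp, ?_⟩
      rw [hzero]
      exact Real.rpow_pos_of_pos (by exact_mod_cast hp) _
  exact EReal.eq_top_iff_forall_lt _ |>.mpr fun w =>
    lt_of_lt_of_le (EReal.coe_lt_coe_iff.mpr (lt_add_one w)) (hall (w + 1))

/-- Only finitely many n violate the bound with constant 1, and the product is positive at each, so
shrinking the constant covers them. -/
theorem exists_prod_distInt_lower_bound {d : ℕ} (α : Fin d → ℝ) {w : ℝ}
    (hw : multExponent α < w) :
    ∃ c : ℝ, 0 < c ∧ ∀ n : ℕ, 0 < n → c * (n : ℝ) ^ (-w) ≤ ∏ i, distInt ((n : ℝ) * α i) := by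
  set S := {n : ℕ | 0 < n ∧ ∏ i, distInt ((n : ℝ) * α i) < (n : ℝ) ^ (-w)} with hS
  have hfin : S.Finite := by
    by_contra h
    exact absurd (show (w : EReal) ≤ multExponent α from le_sSup ⟨w, rfl, h⟩) (not_le.mpr hw)
  have hpos : ∀ n : ℕ, 0 < n → 0 < (∏ i, distInt ((n : ℝ) * α i)) / (n : ℝ) ^ (-w) := fun n hn =>
    div_pos (prod_distInt_pos α (ne_top_of_lt hw) hn)
      (Real.rpow_pos_of_pos (by exact_mod_cast hn) _)
  obtain ⟨c, hc, hcS⟩ : ∃ c : ℝ, 0 < c ∧ ∀ n ∈ S,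
      c ≤ (∏ i, distInt ((n : ℝ) * α i)) / (n : ℝ) ^ (-w) := by
    rcases S.eq_empty_or_nonempty with h | h
    · exact ⟨1, one_pos, by simp [h]⟩
    · obtain ⟨a, ha, hmin⟩ := Set.exists_min_image S
        (fun n : ℕ => (∏ i, distInt ((n : ℝ) * α i)) / (n : ℝ) ^ (-w)) hfin h
      exact ⟨_, hpos a ha.1, hmin⟩
  refine ⟨min c 1, by positivity, fun n hn => ?_⟩
  have hn' : 0 < (n : ℝ) ^ (-w) := Real.rpow_pos_of_pos (by exact_mod_cast hn) _
  by_cases h : n ∈ S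
  · rw [← le_div_iff₀ hn']
    exact (min_le_left _ _).trans (hcS n h)
  · have h1 : (n : ℝ) ^ (-w) ≤ ∏ i, distInt ((n : ℝ) * α i) := by
      by_contra h2
      exact h ⟨hn, not_le.mp h2⟩
    calc min c 1 * (n : ℝ) ^ (-w) ≤ 1 * (n : ℝ) ^ (-w) := by gcongr; exact min_le_right _ _
      _ ≤ _ := by rwa [one_mul]

/-- The inequality d w < d + w is w < d/(d - 1) cleared of its denominator, so that d = 1 needs no
exception. -/
theorem exists_exponent {d : ℕ} (hd : 0 < d) (α : Fin d → ℝ)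
    (hα : multExponent α < exponentThreshold (d + 1)) :
    ∃ w : ℝ, 0 < w ∧ multExponent α < w ∧ d * w < d + w := by
  have h0 : (0 : EReal) < exponentThreshold (d + 1) := by
    rw [exponentThreshold]
    split_ifs with h
    · exact EReal.coe_lt_top 0
    · have h2 : (2 : ℝ) ≤ d := by exact_mod_cast (by omega : 2 ≤ d)
      refine EReal.coe_pos.mpr ?_
      push_cast
      exact div_pos (by linarith) (by linarith)
  obtain ⟨w, h1, h2⟩ := EReal.lt_iff_exists_real_btwn.mp (max_lt hα h0)
  have hw : 0 < w := EReal.coe_pos.mp ((le_max_right _ _).trans_lt h1)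
  refine ⟨w, hw, (le_max_left _ _).trans_lt h1, ?_⟩
  rw [exponentThreshold] at h2
  split_ifs at h2 with h
  · have : d = 1 := by omega
    subst this
    simp
  · have hd2 : (2 : ℝ) ≤ d := by exact_mod_cast (by omega : 2 ≤ d)
    have h3 := EReal.coe_lt_coe_iff.mp h2
    push_cast at h3
    rw [lt_div_iff₀ (by linarith)] at h3
    linarith

/-! ### The lattice attached to a Bohr set -/

section BohrLattice

variable {d : ℕ}

/-- The embedding of `ℤ^(d+1)` sending `(n, z)` to `(n / N, (n α_i - z_i) / δ_i)`. -/
noncomputable def bohrEmbedding (α δ : Fin d → ℝ) (N : ℝ) :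
    (Fin (d + 1) → ℤ) →ₗ[ℤ] EuclideanSpace ℝ (Fin (d + 1)) where
  toFun z := WithLp.toLp 2
    (Fin.cons ((z 0 : ℝ) / N) fun i => ((z 0 : ℝ) * α i - z i.succ) / δ i : Fin (d + 1) → ℝ)
  map_add' x y := by
    ext i
    refine Fin.cases ?_ (fun j => ?_) i
    · simp [add_div]
    · simp; ring
  map_smul' c x := by
    ext i
    refine Fin.cases ?_ (fun j => ?_) i
    · simp [mul_div_assoc]
    · simp; ring

variable {α δ : Fin d → ℝ} {N : ℝ}

theorem bohrEmbedding_zero (z : Fin (d + 1) → ℤ) :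
    bohrEmbedding α δ N z 0 = (z 0 : ℝ) / N := rfl

theorem bohrEmbedding_succ (z : Fin (d + 1) → ℤ) (i : Fin d) :
    bohrEmbedding α δ N z i.succ = ((z 0 : ℝ) * α i - z i.succ) / δ i := rfl

theorem abs_le_mul_norm_bohrEmbedding (hN : 0 < N) (z : Fin (d + 1) → ℤ) :
    |(z 0 : ℝ)| ≤ ‖bohrEmbedding α δ N z‖ * N := by
  have := PiLp.norm_apply_le (bohrEmbedding α δ N z) 0
  rwa [bohrEmbedding_zero, Real.norm_eq_abs, abs_div, abs_of_pos hN, div_le_iff₀ hN] at this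

theorem abs_sub_le_mul_norm_bohrEmbedding (hδ : ∀ i, 0 < δ i) (z : Fin (d + 1) → ℤ) (i : Fin d) :
    |(z 0 : ℝ) * α i - z i.succ| ≤ ‖bohrEmbedding α δ N z‖ * δ i := by
  have := PiLp.norm_apply_le (bohrEmbedding α δ N z) i.succ
  rwa [bohrEmbedding_succ, Real.norm_eq_abs, abs_div, abs_of_pos (hδ i),
    div_le_iff₀ (hδ i)] at this

theorem finite_sublevel_bohrEmbedding (hN : 0 < N) (hδ : ∀ i, 0 < δ i) (R : ℝ) :
    {z | ‖bohrEmbedding α δ N z‖ ≤ R}.Finite := by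
  let b : Fin (d + 1) → ℤ := Fin.cons ⌈R * N⌉ fun i => ⌈R * N * |α i| + R * δ i⌉
  refine (Set.finite_Icc (-b) b).subset fun z hz => ?_
  have hz' : ‖bohrEmbedding α δ N z‖ ≤ R := hz
  have h0 : |(z 0 : ℝ)| ≤ R * N :=
    (abs_le_mul_norm_bohrEmbedding hN z).trans (by gcongr)
  have hb : ∀ i, |z i| ≤ b i := by
    refine Fin.cases ?_ fun i => ?_
    · have : ((|z 0| : ℤ) : ℝ) ≤ R * N := by push_cast; exact h0
      exact Int.cast_le.mp (this.trans (Int.le_ceil _))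
    · have h1 : |(z 0 : ℝ) * α i - z i.succ| ≤ R * δ i :=
        (abs_sub_le_mul_norm_bohrEmbedding (N := N) hδ z i).trans
          (mul_le_mul_of_nonneg_right hz' (hδ i).le)
      have h2 : |(z i.succ : ℝ)| ≤ R * N * |α i| + R * δ i := by
        have h3 : (z i.succ : ℝ) = z 0 * α i - (z 0 * α i - z i.succ) := by ring
        rw [h3]
        refine (abs_sub _ _).trans (add_le_add ?_ h1)
        rw [abs_mul]
        gcongr
      have : ((|z i.succ| : ℤ) : ℝ) ≤ R * N * |α i| + R * δ i := by push_cast; exact h2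
      exact Int.cast_le.mp (this.trans (Int.le_ceil _))
  exact ⟨fun i => (abs_le.mp (hb i)).1, fun i => (abs_le.mp (hb i)).2⟩

/-- A generating family of d + 1 vectors is unimodular, so the covolume can be computed on the
standard basis, where the matrix is triangular. -/
theorem det_gram_bohrEmbedding (v : Fin (d + 1) → Fin (d + 1) → ℤ)
    (hv : ∀ x, ∃ m : Fin (d + 1) → ℤ, x = ∑ i, m i • v i) :
    (Matrix.gram ℝ fun i => bohrEmbedding α δ N (v i)).det = ((∏ i, δ i) * N)⁻¹ ^ 2 := by
  choose m hm using fun i => hv (Pi.single i 1)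
  have hV : (Matrix.of m) * (Matrix.of v) = 1 := by
    ext i j
    have := congrFun (hm i) j
    rw [Matrix.mul_apply, Matrix.one_apply]
    simp only [Pi.single_apply, Finset.sum_apply, Pi.smul_apply, smul_eq_mul] at this
    simp only [Matrix.of_apply, ← this, eq_comm]
  have hdetV : ((Matrix.of v).det : ℝ) ^ 2 = 1 := by
    have h1 : IsUnit (Matrix.of v).det := by
      refine IsUnit.of_mul_eq_one_right (Matrix.of m).det ?_
      rw [← Matrix.det_mul, hV, Matrix.det_one]
    rcases Int.isUnit_iff.mp h1 with h | h <;> rw [h] <;> norm_num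
  let M : Matrix (Fin (d + 1)) (Fin (d + 1)) ℝ :=
    Matrix.of fun i j => bohrEmbedding α δ N (Pi.single i 1) j
  have hVM : (Matrix.of fun i j => bohrEmbedding α δ N (v i) j) =
      (Matrix.of v).map (Int.cast : ℤ → ℝ) * M := by
    ext i j
    have h1 : v i = ∑ l, v i l • (Pi.single l 1 : Fin (d + 1) → ℤ) := by
      ext t
      simp [Pi.single_apply]
    have h2 := congrArg (fun z => bohrEmbedding α δ N z j) h1
    simp only [map_sum, map_smul, WithLp.ofLp_sum, Finset.sum_apply] at h2
    rw [Matrix.of_apply, h2, Matrix.mul_apply]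
    simp [M]
  have hgram : (Matrix.gram ℝ fun i => bohrEmbedding α δ N (v i)) =
      (Matrix.of fun i j => bohrEmbedding α δ N (v i) j) *
        (Matrix.of fun i j => bohrEmbedding α δ N (v i) j).transpose := by
    ext i j
    simp [Matrix.gram_apply, Matrix.mul_apply, PiLp.inner_apply, mul_comm]
  have hM : M.det ^ 2 = ((∏ i, δ i) * N)⁻¹ ^ 2 := by
    have htri : M.IsUpperTriangular := by
      intro i j hij
      revert hij
      refine Fin.cases ?_ (fun s => ?_) i
      · exact fun h => absurd h (Fin.not_lt_zero j)
      · refine Fin.cases ?_ (fun t => ?_) j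
        · simp [M, bohrEmbedding_zero]
        · intro h
          have hne : t ≠ s := fun e => by simp [e] at h
          simp [M, bohrEmbedding_succ, hne]
    rw [Matrix.det_of_isUpperTriangular htri, Fin.prod_univ_succ]
    have h0 : M 0 0 = N⁻¹ := by simp [M, bohrEmbedding_zero]
    have hs : ∀ i : Fin d, M i.succ i.succ = -(δ i)⁻¹ := fun i => by
      simp [M, bohrEmbedding_succ, neg_div]
    simp only [h0, hs]
    rw [Finset.prod_neg, Finset.prod_inv_distrib]
    simp [mul_pow, mul_comm, ← pow_mul]
  have hcast : ((Matrix.of v).map (Int.cast : ℤ → ℝ)).det = ((Matrix.of v).det : ℝ) :=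
    (Int.cast_det _).symm
  rw [hgram, Matrix.det_mul, Matrix.det_transpose, hVM, Matrix.det_mul, hcast, ← hM]
  linear_combination M.det ^ 2 * hdetV

end BohrLattice

/-! ### Counting progressions and bounding lattice vectors from below -/

theorem genArithProg_subset_image {k : ℕ} (b : ℤ) (A L : Fin k → ℕ) :
    genArithProg b A L ⊆ (fun m : Fin k → ℤ => b + ∑ i, (A i : ℤ) * m i) ''
      (Fintype.piFinset fun i => Finset.Icc (-(L i : ℤ)) (L i) : Finset (Fin k → ℤ)) := by
  rintro n ⟨m, hm, rfl⟩
  exact ⟨m, by simpa [abs_le, Pi.le_def, forall_and] using hm, rfl⟩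

theorem finite_genArithProg {k : ℕ} (b : ℤ) (A L : Fin k → ℕ) : (genArithProg b A L).Finite :=
  ((Finset.finite_toSet _).image _).subset (genArithProg_subset_image b A L)

theorem ncard_genArithProg_le {k : ℕ} (b : ℤ) (A L : Fin k → ℕ) :
    (genArithProg b A L).ncard ≤ ∏ i, (2 * L i + 1) := by
  refine (Set.ncard_le_ncard (genArithProg_subset_image b A L)
    ((Finset.finite_toSet _).image _)).trans ?_
  refine (Set.ncard_image_le (Finset.finite_toSet _)).trans ?_
  rw [Set.ncard_coe_finset, Fintype.card_piFinset]
  refine le_of_eq (Finset.prod_congr rfl fun i _ => ?_)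
  rw [Int.card_Icc]
  omega

theorem rpow_le_prod_mul {d : ℕ} {δ : Fin d → ℝ} {N τ : ℝ} (hN : 1 ≤ N)
    (hδ : ∀ i, N ^ (-τ) ≤ δ i) : N ^ (1 - d * τ) ≤ (∏ i, δ i) * N := by
  have hN0 : 0 < N := by linarith
  have h1 : ∏ _i : Fin d, N ^ (-τ) ≤ ∏ i, δ i :=
    Finset.prod_le_prod (fun i _ => (Real.rpow_pos_of_pos hN0 _).le) fun i _ => hδ i
  rw [Finset.prod_const, Finset.card_univ, Fintype.card_fin, ← Real.rpow_natCast,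
    ← Real.rpow_mul hN0.le] at h1
  calc N ^ (1 - d * τ) = N ^ (-τ * d) * N := by
        rw [sub_eq_neg_add, Real.rpow_add hN0, Real.rpow_one]
        ring_nf
    _ ≤ _ := by gcongr

/-- Write μ for the norm and n = z 0. If n ≠ 0, then |n| ≤ μN and ‖nα_i‖ ≤ 2μ, so c(μN)^(-w) ≤
(2μ)^d and μ^d ≫ N^(-dw/(d+w)); the condition on τ makes P ≥ N^(1-dτ) compensate. If n = 0, some z_i
is a nonzero integer, so μ ≥ 1/2, and P ≥ 1. -/
theorem bohrEmbedding_norm_lower_bound {d : ℕ} (hd : 0 < d) {α δ : Fin d → ℝ} {N τ w c : ℝ}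
    (hw : 0 < w) (hc : 0 < c)
    (hα : ∀ n : ℕ, 0 < n → c * (n : ℝ) ^ (-w) ≤ ∏ i, distInt ((n : ℝ) * α i))
    (hN : 1 ≤ N) (hτ : d * τ ≤ 1 - d * w / (d + w)) (hδ : ∀ i, N ^ (-τ) ≤ δ i ∧ δ i ≤ 2)
    {z : Fin (d + 1) → ℤ} (hz : z ≠ 0) :
    min ((1 / 2) ^ d) ((c / 2 ^ d) ^ (d / (d + w))) ≤
      ‖bohrEmbedding α δ N z‖ ^ d * ((∏ i, δ i) * N) := by
  have hN0 : 0 < N := by linarith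
  have hd0 : (0 : ℝ) < d := by exact_mod_cast hd
  have hδ0 : ∀ i, 0 < δ i := fun i => (Real.rpow_pos_of_pos hN0 _).trans_le (hδ i).1
  have hP := rpow_le_prod_mul hN fun i => (hδ i).1
  have hθ : 0 < d * w / (d + w) := by positivity
  set μ := ‖bohrEmbedding α δ N z‖ with hμ
  have hμ0 : 0 ≤ μ := norm_nonneg _
  have hz0 : |(z 0 : ℝ)| ≤ μ * N := abs_le_mul_norm_bohrEmbedding hN0 z
  have hzi : ∀ i, |(z 0 : ℝ) * α i - z i.succ| ≤ 2 * μ := fun i => by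
    have := abs_sub_le_mul_norm_bohrEmbedding (N := N) (α := α) hδ0 z i
    nlinarith [(hδ i).2]
  by_cases h0 : z 0 = 0
  · obtain ⟨i, hi⟩ : ∃ i : Fin d, z i.succ ≠ 0 := by
      by_contra! h
      exact hz (funext (Fin.cases h0 h))
    have h1 : 1 ≤ 2 * μ := by
      refine le_trans ?_ (hzi i)
      rw [h0]
      have := Int.one_le_abs hi
      have : (1 : ℝ) ≤ |(z i.succ : ℝ)| := by exact_mod_cast this
      simpa using this
    refine (min_le_left _ _).trans ?_
    have h2 : 1 ≤ (∏ i, δ i) * N :=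
      (Real.one_le_rpow hN (by linarith)).trans hP
    calc (1 / 2 : ℝ) ^ d ≤ μ ^ d := by gcongr; linarith
      _ ≤ μ ^ d * ((∏ i, δ i) * N) := le_mul_of_one_le_right (by positivity) h2
  · refine (min_le_right _ _).trans ?_
    have hn : 0 < (z 0).natAbs := Int.natAbs_pos.mpr h0
    have hncast : (((z 0).natAbs : ℕ) : ℝ) = |(z 0 : ℝ)| := by
      rw [Nat.cast_natAbs, Int.cast_abs]
    have hnpos : (0 : ℝ) < (z 0).natAbs := by exact_mod_cast hn
    have hμpos : 0 < μ := by
      by_contra h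
      have : μ = 0 := le_antisymm (not_lt.mp h) hμ0
      rw [this, zero_mul, ← hncast] at hz0
      linarith
    have hdist : ∀ i, distInt (((z 0).natAbs : ℝ) * α i) ≤ 2 * μ := fun i => by
      have h1 : distInt ((z 0 : ℝ) * α i) ≤ 2 * μ := (distInt_le_abs_sub _ _).trans (hzi i)
      rw [hncast]
      rcases abs_choice (z 0 : ℝ) with h | h <;> rw [h]
      · exact h1
      · rw [neg_mul]
        exact (distInt_neg_le _).trans h1
    have h1 : c * (μ * N) ^ (-w) ≤ 2 ^ d * μ ^ d := by
      calc c * (μ * N) ^ (-w) ≤ c * ((z 0).natAbs : ℝ) ^ (-w) := by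
            refine mul_le_mul_of_nonneg_left ?_ hc.le
            exact Real.rpow_le_rpow_of_nonpos hnpos (hncast ▸ hz0) (by linarith)
        _ ≤ ∏ i, distInt (((z 0).natAbs : ℝ) * α i) := hα _ hn
        _ ≤ ∏ _i : Fin d, 2 * μ :=
            Finset.prod_le_prod (fun i _ => distInt_nonneg _) fun i _ => hdist i
        _ = 2 ^ d * μ ^ d := by simp [mul_pow]
    have h2 : c / 2 ^ d * N ^ (-w) ≤ μ ^ ((d : ℝ) + w) := by
      have h3 := mul_le_mul_of_nonneg_right h1 (Real.rpow_nonneg hμ0 w)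
      have h4 : (μ * N) ^ (-w) * μ ^ w = N ^ (-w) := by
        rw [Real.mul_rpow hμ0 hN0.le, mul_right_comm, ← Real.rpow_add hμpos]
        simp
      rw [Real.rpow_add hμpos, Real.rpow_natCast, div_mul_eq_mul_div, div_le_iff₀ (by positivity)]
      calc c * N ^ (-w) = c * (μ * N) ^ (-w) * μ ^ w := by rw [mul_assoc, h4]
        _ ≤ 2 ^ d * μ ^ d * μ ^ w := h3
        _ = _ := by ring
    have h5 : (c / 2 ^ d) ^ ((d : ℝ) / (d + w)) * N ^ (-(d * w / (d + w))) ≤ μ ^ d := by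
      have h6 := Real.rpow_le_rpow (by positivity) h2 (z := (d : ℝ) / (d + w)) (by positivity)
      rw [Real.mul_rpow (by positivity) (by positivity), ← Real.rpow_mul hN0.le,
        ← Real.rpow_mul hμ0, mul_div_cancel₀ _ (by positivity), Real.rpow_natCast] at h6
      convert h6 using 3
      ring
    calc (c / 2 ^ d) ^ ((d : ℝ) / (d + w))
        ≤ (c / 2 ^ d) ^ ((d : ℝ) / (d + w)) * N ^ (-(d * w / (d + w)) + (1 - d * τ)) := by
          refine le_mul_of_one_le_right (by positivity) (Real.one_le_rpow hN (by linarith))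
      _ = (c / 2 ^ d) ^ ((d : ℝ) / (d + w)) * N ^ (-(d * w / (d + w))) * N ^ (1 - d * τ) := by
          rw [Real.rpow_add hN0, mul_assoc]
      _ ≤ μ ^ d * ((∏ i, δ i) * N) := by gcongr

theorem exists_bohrEmbedding_norm_le {d : ℕ} {α δ : Fin d → ℝ} {N : ℕ} (hN : 0 < N)
    (hδ : ∀ i, 0 < δ i) {n : ℤ} (hn : n ∈ bohrSet α 0 N δ) :
    ∃ z : Fin (d + 1) → ℤ, z 0 = n ∧ ‖bohrEmbedding α δ N z‖ ≤ d + 1 := by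
  obtain ⟨hnN, hni⟩ := hn
  have hN0 : (0 : ℝ) < N := by exact_mod_cast hN
  refine ⟨Fin.cons n fun i => round ((n : ℝ) * α i), rfl, ?_⟩
  set z : Fin (d + 1) → ℤ := Fin.cons n fun i => round ((n : ℝ) * α i) with hz
  have hcoord : ∀ i, ‖bohrEmbedding α δ N z i‖ ≤ 1 := by
    refine Fin.cases ?_ fun i => ?_
    · rw [bohrEmbedding_zero, Real.norm_eq_abs, abs_div, abs_of_pos hN0, div_le_one hN0]
      have : ((|n| : ℤ) : ℝ) ≤ N := by exact_mod_cast hnN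
      simpa [hz] using this
    · rw [bohrEmbedding_succ, Real.norm_eq_abs, abs_div, abs_of_pos (hδ i), div_le_one (hδ i)]
      simpa [hz, distInt] using hni i
  rw [EuclideanSpace.norm_eq]
  refine Real.sqrt_le_iff.mpr ⟨by positivity, ?_⟩
  calc ∑ i, ‖bohrEmbedding α δ N z i‖ ^ 2 ≤ ∑ _i : Fin (d + 1), (1 : ℝ) :=
        Finset.sum_le_sum fun i _ => pow_le_one₀ (norm_nonneg _) (hcoord i)
    _ = d + 1 := by simp
    _ ≤ (d + 1) ^ 2 := by nlinarith [(Nat.cast_nonneg d : (0 : ℝ) ≤ d)]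

/-- If all factors are at least `t` in the sense `t ≤ a i ^ d`, a bound on the product of `d + 1`
numbers bounds each of them. -/
theorem mul_le_prod_of_le_pow {d : ℕ} (hd : 0 < d) {a : Fin (d + 1) → ℝ} (ha : ∀ i, 0 ≤ a i)
    {t : ℝ} (ht : 0 ≤ t) (h : ∀ i, t ≤ a i ^ d) (j : Fin (d + 1)) : a j * t ≤ ∏ i, a i := by
  rw [← Finset.mul_prod_erase Finset.univ a (Finset.mem_univ j)]
  refine mul_le_mul_of_nonneg_left ?_ (ha j)
  -- Taking d-th powers matches t^d with the d factors that remain.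
  refine le_of_pow_le_pow_left₀ hd.ne' (Finset.prod_nonneg fun i _ => ha i) ?_
  rw [← Finset.prod_pow]
  calc t ^ d = ∏ _i ∈ Finset.univ.erase j, t := by
        rw [Finset.prod_const, Finset.card_erase_of_mem (Finset.mem_univ j)]
        simp
    _ ≤ _ := Finset.prod_le_prod (fun _ _ => ht) fun i _ => h i

/-! ### Outer progression for homogeneous Bohr sets -/

theorem bohrSet_outer_structure {d : ℕ} (hd : 0 < d) (α : Fin d → ℝ)
    (hα : multExponent α < exponentThreshold (d + 1)) :
    ∃ τ₀ : ℝ, 0 < τ₀ ∧ ∃ C : ℝ, 0 < C ∧ ∀ τ : ℝ, τ ≤ τ₀ → ∀ N : ℕ, 1 ≤ N →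
      ∀ δ : Fin d → ℝ, (∀ i, (N : ℝ) ^ (-τ) ≤ δ i ∧ δ i ≤ 2) →
        ∃ A L : Fin (d + 1) → ℕ, (∀ i, 0 < A i) ∧ (∀ i, 0 < L i) ∧
          bohrSet α 0 N δ ⊆ genArithProg 0 A L ∧ (genArithProg 0 A L).Finite ∧
          ((genArithProg 0 A L).ncard : ℝ) ≤ C * ((∏ i, δ i) * (N : ℝ)) := by
  obtain ⟨w, hw, hαw, hdw⟩ := exists_exponent hd α hα
  obtain ⟨c, hc, hcα⟩ := exists_prod_distInt_lower_bound α hαw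
  obtain ⟨K, hK, B, hB, hred⟩ := exists_reduced_family (EuclideanSpace ℝ (Fin (d + 1))) (d + 1)
  have hd0 : (0 : ℝ) < d := by exact_mod_cast hd
  set c' : ℝ := min ((1 / 2) ^ d) ((c / 2 ^ d) ^ ((d : ℝ) / (d + w))) with hc'
  have hc'0 : 0 < c' := lt_min (by positivity) (by positivity)
  -- The first term bounds the coefficients of points of norm at most d + 1; the second absorbs the
  -- + 1 in `L`, since ‖f (v i)‖ ≤ √B / c'.
  set D : ℝ := K * (d + 1) + √B / c' with hD
  have hη : 0 < 1 - d * w / (d + w) := by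
    rw [sub_pos, div_lt_one (by positivity)]
    exact hdw
  refine ⟨(1 - d * w / (d + w)) / d, by positivity, (3 * D) ^ (d + 1), by positivity,
    fun τ hτ N hN δ hδ => ?_⟩
  have hN1 : (1 : ℝ) ≤ N := by exact_mod_cast hN
  have hN0 : (0 : ℝ) < N := by linarith
  have hδ0 : ∀ i, 0 < δ i := fun i => (Real.rpow_pos_of_pos hN0 _).trans_le (hδ i).1
  have hτ' : d * τ ≤ 1 - d * w / (d + w) := by
    rw [le_div_iff₀ hd0] at hτ
    linarith
  set f := bohrEmbedding α δ N with hf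
  set P : ℝ := (∏ i, δ i) * N with hP
  have hP0 : 0 < P := mul_pos (Finset.prod_pos fun i _ => hδ0 i) hN0
  obtain ⟨v, hv0, hspan, hupp, hlow⟩ := hred _ f (finite_sublevel_bohrEmbedding hN0 hδ0) (by simp)
  rw [det_gram_bohrEmbedding v fun x => (hspan x).imp fun m hm => hm.1] at hupp hlow
  rw [Finset.prod_pow] at hupp hlow
  have hlow' : P⁻¹ ≤ ∏ i, ‖f (v i)‖ :=
    le_of_sq_le_sq hlow (Finset.prod_nonneg fun i _ => norm_nonneg _)
  have hupp' : ∏ i, ‖f (v i)‖ ≤ √B * P⁻¹ := by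
    refine le_of_sq_le_sq ?_ (by positivity)
    rwa [mul_pow, Real.sq_sqrt hB.le]
  have hpos : ∀ i, 0 < ‖f (v i)‖ := fun i =>
    norm_pos_of_finite_sublevel f (finite_sublevel_bohrEmbedding hN0 hδ0) (hv0 i)
  have hbd : ∀ j, ‖f (v j)‖ ≤ √B / c' := fun j => by
    have h1 : ‖f (v j)‖ * (c' * P⁻¹) ≤ √B * P⁻¹ := by
      refine (mul_le_prod_of_le_pow hd (fun i => norm_nonneg (f (v i))) (by positivity)
        (fun i => ?_) j).trans hupp'
      rw [← div_eq_mul_inv, div_le_iff₀ hP0]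
      exact bohrEmbedding_norm_lower_bound hd hw hc hcα hN1 hτ' hδ (hv0 i)
    rw [← mul_assoc] at h1
    rw [le_div_iff₀ hc'0]
    exact le_of_mul_le_mul_right h1 (by positivity)
  let L : Fin (d + 1) → ℕ := fun i => ⌊K * (d + 1) / ‖f (v i)‖⌋₊ + 1
  have hL : ∀ i, (L i : ℝ) ≤ D / ‖f (v i)‖ := fun i => by
    have h1 : (⌊K * (d + 1) / ‖f (v i)‖⌋₊ : ℝ) ≤ K * (d + 1) / ‖f (v i)‖ :=
      Nat.floor_le (by positivity)
    have h2 : 1 ≤ √B / c' / ‖f (v i)‖ := (one_le_div (hpos i)).mpr (hbd i)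
    simp only [L, hD, add_div]
    push_cast
    linarith
  -- Steps must be positive: signs move into the coefficients, and when `v i 0 = 0` the step is 1
  -- with coefficient multiplied by sign 0.
  refine ⟨fun i => max 1 (v i 0).natAbs, L, fun i => by positivity, fun i => Nat.succ_pos _, ?_,
    finite_genArithProg _ _ _, ?_⟩
  · intro n hn
    obtain ⟨z, hz0, hzn⟩ := exists_bohrEmbedding_norm_le hN hδ0 hn
    obtain ⟨m, hm, hmK⟩ := hspan z
    have hsign : ∀ i, ((max 1 (v i 0).natAbs : ℕ) : ℤ) * (v i 0).sign = v i 0 := fun i => by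
      by_cases h : v i 0 = 0
      · simp [h]
      · rw [max_eq_right (Int.natAbs_pos.mpr h), mul_comm, Int.sign_mul_natAbs]
    have hml : ∀ i, |m i| ≤ (L i : ℤ) := fun i => by
      have h1 : |(m i : ℝ)| ≤ K * (d + 1) / ‖f (v i)‖ := by
        rw [le_div_iff₀ (hpos i)]
        exact (hmK i).trans (by gcongr)
      have h2 : ((|m i| : ℤ) : ℝ) < ((L i : ℤ) : ℝ) := by
        simp only [L]
        push_cast
        exact h1.trans_lt (Nat.lt_floor_add_one _)
      exact (Int.cast_lt.mp h2).le
    refine ⟨fun i => (v i 0).sign * m i, fun i => ?_, ?_⟩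
    · rw [abs_mul]
      refine le_trans (mul_le_of_le_one_left (abs_nonneg _) ?_) (hml i)
      rcases Int.sign_trichotomy (v i 0) with h | h | h <;> simp [h]
    · have h3 := congrFun hm 0
      simp only [Finset.sum_apply, Pi.smul_apply, smul_eq_mul] at h3
      rw [← hz0, h3, zero_add]
      refine Finset.sum_congr rfl fun i _ => ?_
      rw [← mul_assoc, hsign, mul_comm]
  · calc ((genArithProg 0 (fun i => max 1 (v i 0).natAbs) L).ncard : ℝ)
        ≤ ((∏ i, (2 * L i + 1) : ℕ) : ℝ) := by exact_mod_cast ncard_genArithProg_le _ _ _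
      _ = ∏ i, (2 * (L i : ℝ) + 1) := by push_cast; rfl
      _ ≤ ∏ i, (3 * D / ‖f (v i)‖) := by
          refine Finset.prod_le_prod (fun i _ => by positivity) fun i _ => ?_
          have h1 : (1 : ℝ) ≤ L i := by exact_mod_cast Nat.succ_pos _
          have h2 := hL i
          rw [mul_div_assoc]
          linarith
      _ = (3 * D) ^ (d + 1) * (∏ i, ‖f (v i)‖)⁻¹ := by
          rw [Finset.prod_div_distrib]
          simp [div_eq_mul_inv]
      _ ≤ (3 * D) ^ (d + 1) * P := by
          gcongr
          exact inv_le_of_inv_le₀ hP0 hlow'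

/-! ### Inhomogeneous Bohr sets by differencing -/

theorem distInt_sub_le (x y : ℝ) : distInt (x - y) ≤ distInt x + distInt y := by
  refine (distInt_le_abs_sub (x - y) (round x - round y)).trans ?_
  have : x - y - ((round x - round y : ℤ) : ℝ) = (x - round x) - (y - round y) := by
    push_cast
    ring
  rw [this]
  exact abs_sub _ _

theorem sub_mem_bohrSet {d : ℕ} {α γ δ : Fin d → ℝ} {N : ℕ} {a b : ℤ}
    (ha : a ∈ bohrSet α γ N δ) (hb : b ∈ bohrSet α γ N δ) :
    a - b ∈ bohrSet α 0 (2 * N) (fun i => 2 * δ i) := by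
  refine ⟨?_, fun i => ?_⟩
  · have h1 := ha.1
    have h2 := hb.1
    push_cast
    exact (abs_sub a b).trans (by linarith)
  · have h1 := distInt_sub_le ((a : ℝ) * α i - γ i) ((b : ℝ) * α i - γ i)
    have h2 : ((a - b : ℤ) : ℝ) * α i - (0 : Fin d → ℝ) i =
        (a : ℝ) * α i - γ i - ((b : ℝ) * α i - γ i) := by
      simp
      ring
    rw [h2]
    linarith [ha.2 i, hb.2 i]

theorem finite_bohrSet {d : ℕ} (α γ : Fin d → ℝ) (N : ℕ) (δ : Fin d → ℝ) :
    (bohrSet α γ N δ).Finite :=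
  (Set.finite_Icc (-(N : ℤ)) N).subset fun _ hn => abs_le.mp hn.1

/-- Subtracting one fixed element is injective and removes γ, at the cost of doubling N and the
widths. -/
theorem ncard_bohrSet_le {d : ℕ} (α γ : Fin d → ℝ) (N : ℕ) (δ : Fin d → ℝ) :
    (bohrSet α γ N δ).ncard ≤ (bohrSet α 0 (2 * N) fun i => 2 * δ i).ncard := by
  rcases (bohrSet α γ N δ).eq_empty_or_nonempty with h | ⟨b, hb⟩
  · simp [h]
  · exact Set.ncard_le_ncard_of_injOn (fun a => a - b) (fun a ha => sub_mem_bohrSet ha hb)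
      (fun x _ y _ h => by simpa using h) (finite_bohrSet _ _ _ _)

theorem bohrSet_structure {d : ℕ} (hd : 0 < d) (α : Fin d → ℝ)
    (hα : multExponent α < exponentThreshold (d + 1)) :
    ∃ τ₀ : ℝ, 0 < τ₀ ∧ ∃ C : ℝ, 0 < C ∧ ∃ N₀ : ℕ,
      ∀ τ : ℝ, 0 < τ → τ ≤ τ₀ → ∀ N : ℕ, N₀ ≤ N →
        (∀ δ : Fin d → ℝ, (∀ i, (N : ℝ) ^ (-τ) ≤ δ i ∧ δ i ≤ 2) →
          ∃ A L : Fin (d + 1) → ℕ, (∀ i, 0 < A i) ∧ (∀ i, 0 < L i) ∧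
            bohrSet α 0 N δ ⊆ genArithProg 0 A L ∧
            (genArithProg 0 A L).Finite ∧
            ((genArithProg 0 A L).ncard : ℝ) ≤ C * ((∏ i, δ i) * (N : ℝ))) ∧
        (∀ γ δ : Fin d → ℝ, (∀ i, (N : ℝ) ^ (-τ) ≤ δ i ∧ δ i ≤ 1) →
          (bohrSet α γ N δ).Finite ∧
          ((bohrSet α γ N δ).ncard : ℝ) ≤ C * ((∏ i, δ i) * (N : ℝ))) := by
  obtain ⟨τ₀, hτ₀, C, hC, h⟩ := bohrSet_outer_structure hd α hα
  -- The factor 2^(d+1) pays for doubling d widths and N; the doubled widths stay at most 2, the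
  -- range allowed for the outer structure.
  refine ⟨τ₀, hτ₀, C * 2 ^ (d + 1), by positivity, 1, fun τ hτ0 hτ N hN => ⟨fun δ hδ => ?_,
    fun γ δ hδ => ⟨finite_bohrSet _ _ _ _, ?_⟩⟩⟩
  all_goals
    have hN0 : (0 : ℝ) < N := by exact_mod_cast hN
    have hδ0 : ∀ i, 0 < δ i := fun i => (Real.rpow_pos_of_pos hN0 _).trans_le (hδ i).1
    have hP : 0 ≤ (∏ i, δ i) * (N : ℝ) :=
      mul_nonneg (Finset.prod_nonneg fun i _ => (hδ0 i).le) hN0.le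
  · obtain ⟨A, L, hA, hL, hsub, hfin, hcard⟩ := h τ hτ N hN δ hδ
    refine ⟨A, L, hA, hL, hsub, hfin, hcard.trans ?_⟩
    gcongr
    exact le_mul_of_one_le_right hC.le (one_le_pow₀ one_le_two)
  · have hδ2 : ∀ i, ((2 * N : ℕ) : ℝ) ^ (-τ) ≤ 2 * δ i ∧ 2 * δ i ≤ 2 := fun i => by
      have h1 : ((2 * N : ℕ) : ℝ) ^ (-τ) ≤ (N : ℝ) ^ (-τ) := by
        refine Real.rpow_le_rpow_of_nonpos hN0 ?_ (by linarith)
        push_cast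
        linarith
      exact ⟨by linarith [(hδ i).1, hδ0 i], by linarith [(hδ i).2]⟩
    obtain ⟨A, L, -, -, hsub, hfin, hcard⟩ := h τ hτ (2 * N) (by omega) (fun i => 2 * δ i) hδ2
    calc ((bohrSet α γ N δ).ncard : ℝ)
        ≤ ((genArithProg 0 A L).ncard : ℝ) := by
          exact_mod_cast (ncard_bohrSet_le α γ N δ).trans (Set.ncard_le_ncard hsub hfin)
      _ ≤ C * ((∏ i, (2 * δ i)) * ((2 * N : ℕ) : ℝ)) := hcard
      _ = C * 2 ^ (d + 1) * ((∏ i, δ i) * (N : ℝ)) := by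
          rw [Finset.prod_mul_distrib]
          simp
          ring

theorem corollary3p3 (k : ℕ) (hk : 2 ≤ k) (α : Fin (k - 1) → ℝ)
    (hα : multExponent α < exponentThreshold k) :
    ∃ τ₀ : ℝ, 0 < τ₀ ∧ ∃ C : ℝ, 0 < C ∧ ∃ N₀ : ℕ,
      ∀ τ : ℝ, 0 < τ → τ ≤ τ₀ → ∀ N : ℕ, N₀ ≤ N →
        (∀ δ : Fin (k - 1) → ℝ, (∀ i, (N : ℝ) ^ (-τ) ≤ δ i ∧ δ i ≤ 2) →
          ∃ A L : Fin k → ℕ, (∀ i, 0 < A i) ∧ (∀ i, 0 < L i) ∧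
            bohrSet α 0 N δ ⊆ genArithProg 0 A L ∧
            (genArithProg 0 A L).Finite ∧
            ((genArithProg 0 A L).ncard : ℝ) ≤ C * ((∏ i, δ i) * (N : ℝ))) ∧
        (∀ γ δ : Fin (k - 1) → ℝ, (∀ i, (N : ℝ) ^ (-τ) ≤ δ i ∧ δ i ≤ 1) →
          (bohrSet α γ N δ).Finite ∧
          ((bohrSet α γ N δ).ncard : ℝ) ≤ C * ((∏ i, δ i) * (N : ℝ))) := by
  obtain ⟨d, rfl⟩ : ∃ d, k = d + 1 := ⟨k - 1, by omega⟩
  exact bohrSet_structure (by omega) α hα
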